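/- Let $P=(X,\prec)$ be a finite poset with $|X|=n$, and let $A,B\subseteq X$ be nonempty (otherwise arbitrary) subsets. Let $f$ be a uniformly random linear extension of $P$, i.e. a uniformly random bijection $f:X\to\{1,\dots,n\}$ such that $f(x)<f(y)$ whenever $x\prec y$, and for nonempty $S\subseteq X$ write $f_{\min}(S):=\min\{f(x):x\in S\}$. Then $$\frac{\mathbb{E}\big[f_{\min}(A)\,f_{\min}(B)\big]+\mathbb{E}\big[f_{\min}(A\cup B)\big]}{\mathbb{E}\big[f_{\min}(A)\big]\cdot\mathbb{E}\big[f_{\min}(B)\big]}\ \le\ 2 .$$ -/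

import Mathlib

/-- The linear extensions of a finite poset `X` with `n` elements: the bijections `f` from `X` to an
`n`-element chain with `f x < f y` whenever `x < y`.  The chain is `Fin n = {0, …, n - 1}`;
the labels `1, …, n` are obtained by the shift in `LinExt.label`. -/
def LinExt (X : Type*) [PartialOrder X] [Fintype X] : Type _ :=
  {f : X ≃ Fin (Fintype.card X) // StrictMono f}

namespace LinExt

noncomputable instance instFintype (X : Type*) [PartialOrder X] [Fintype X] :
    Fintype (LinExt X) := by
  classical
  exact inferInstanceAs (Fintype {f : X ≃ Fin (Fintype.card X) // StrictMono f})

/-- The label `f(x) ∈ {1, …, n}` of the element `x`. -/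
def label {X : Type*} [PartialOrder X] [Fintype X] (f : LinExt X) (x : X) : ℕ :=
  (f.1 x : ℕ) + 1

/-- `f_min(A) = min {f(x) : x ∈ A}`, the smallest label on `A` (meaningful for nonempty `A`). -/
noncomputable def minLabel {X : Type*} [PartialOrder X] [Fintype X] (f : LinExt X)
    (A : Set X) : ℕ :=
  sInf (f.label '' A)

/-- The expectation of `g(f)` for a uniformly random linear extension `f` of `X`. -/
noncomputable def expectation {X : Type*} [PartialOrder X] [Fintype X]
    (g : LinExt X → ℝ) : ℝ :=
  Finset.univ.expect g

/-- Every finite poset has a linear extension, so the uniform distribution makes sense. -/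
theorem nonempty (X : Type*) [PartialOrder X] [Fintype X] : Nonempty (LinExt X) := by
  let : Fintype (LinearExtension X) := inferInstanceAs (Fintype X)
  let e : LinearExtension X ≃o Fin (Fintype.card X) :=
    (Fintype.orderIsoFinOfCardEq (LinearExtension X) rfl).symm
  refine ⟨⟨⟨fun x => e (toLinearExtension x), fun i => e.symm i, fun x => ?_, fun i => ?_⟩, ?_⟩⟩
  · exact e.symm_apply_apply (toLinearExtension x)
  · exact e.apply_symm_apply i
  · intro x y h
    refine e.strictMono (lt_of_le_of_ne (toLinearExtension.monotone h.le) ?_)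
    exact fun h' => h.ne h'

/-- The expectation of the smallest label on a nonempty set is at least `1`; in particular,
it is nonzero. -/
theorem one_le_expectation_minLabel {X : Type*} [PartialOrder X] [Fintype X] {A : Set X}
    (hA : A.Nonempty) : 1 ≤ expectation (fun f : LinExt X => (f.minLabel A : ℝ)) := by
  have := nonempty X
  refine Finset.le_expect Finset.univ_nonempty fun f _ => ?_
  obtain ⟨x, -, hx⟩ := Nat.sInf_mem (hA.image f.label)
  have h : 1 ≤ f.minLabel A := by
    unfold minLabel
    rw [← hx]
    exact Nat.succ_pos _
  exact_mod_cast h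

end LinExt

/-! Adjoin to the poset an element `α` below `A` and an element `β` below `B`, with no other
relations. A linear extension `f` leaves `f_min(A)` gaps for `α` and `f_min(B)` gaps for `β`, and in
a common gap both orders are possible, so it extends in `f_min(A) f_min(B) + f_min(A ∪ B)` ways. If
`e` counts linear extensions and `S` is the enlarged poset, the claim becomes `e(S - α - β) e(S) ≤ 2
e(S - α) e(S - β)` for two minimal elements (`numExt_mul_le_two_mul`).

This is the inequality `H_S(v) e(S) ≤ (∑ v_x e(S - x))²` (`hessForm_hyperbolic`) tested on a vector
supported on `{α, β}`; the matrix of `H_S` has off-diagonal entries `e(S - x - y)` and row sums `e(S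
- x)`. The proof is by induction on `S`. By `hessForm_le_sum`, `H_S(v)` is at most a sum of forms
`H_{S - a}`, which the induction hypothesis bounds by `(M v)_a² / e(S - a)`. This excludes
eigenvalues of the normalised matrix in `(0, 1)`, while positivity bounds them by `1`, attained on a
single line; so there is one positive direction (`hyperbolic_of_le_sum_sq_div`). -/

/-! ### A spectral criterion for hyperbolicity -/

/-- A symmetric operator `T` with `T ≤ T²`, all of whose vectors with Rayleigh quotient at least
`1` lie on the line spanned by `s`, is negative semidefinite on the orthogonal complement of `s`. -/
theorem LinearMap.IsSymmetric.inner_apply_nonpos_of_inner_eq_zero {E : Type*}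
    [NormedAddCommGroup E] [InnerProductSpace ℝ E] [FiniteDimensional ℝ E] {T : E →ₗ[ℝ] E}
    (hT : T.IsSymmetric) (s : E) (hsq : ∀ x, inner ℝ x (T x) ≤ inner ℝ (T x) (T x))
    (hline : ∀ x, inner ℝ x x ≤ inner ℝ x (T x) → ∃ c : ℝ, x = c • s) (w : E)
    (hw : inner ℝ s w = 0) : inner ℝ w (T w) ≤ 0 := by
  have hn : Module.finrank ℝ E = Module.finrank ℝ E := rfl
  set b := hT.eigenvectorBasis hn with hb
  rw [← b.sum_inner_mul_inner w (T w)]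
  refine Finset.sum_nonpos fun k _ => ?_
  have hk : T (b k) = (hT.eigenvalues hn k : ℝ) • b k := hT.apply_eigenvectorBasis hn k
  set l : ℝ := hT.eigenvalues hn k
  have hbb : inner ℝ (b k) (b k) = (1 : ℝ) := by
    rw [real_inner_self_eq_norm_sq, b.orthonormal.1 k]; norm_num
  rw [← hT (b k) w, hk, real_inner_smul_left, real_inner_comm]
  have h1 := hsq (b k)
  rw [hk, real_inner_smul_left, real_inner_smul_right, hbb] at h1
  -- `h1` says `l ≤ l²`, so a positive eigenvalue is at least `1`; its eigenvector is then a
  -- multiple of `s`, orthogonal to `w`.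
  by_cases hl : l ≤ 0
  · nlinarith [mul_self_nonneg (inner ℝ (b k) w)]
  · have hl1 : 1 ≤ l := by
      push Not at hl
      nlinarith
    obtain ⟨c, hc⟩ := hline (b k) (by rw [hk, real_inner_smul_right, hbb]; linarith)
    have : inner ℝ (b k) w = (0 : ℝ) := by rw [hc, real_inner_smul_left, hw, mul_zero]
    rw [this]; simp

/-- The Dirichlet form of a symmetric matrix. -/
theorem sum_sum_mul_sub_sq {ι : Type*} [Fintype ι] (M : ι → ι → ℝ)
    (hM : ∀ i j, M i j = M j i) (v : ι → ℝ) :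
    ∑ i, ∑ j, M i j * (v i - v j) ^ 2
      = 2 * (∑ i, (∑ j, M i j) * v i ^ 2 - ∑ i, v i * ∑ j, M i j * v j) := by
  have h1 : ∑ i, ∑ j, M i j * v j ^ 2 = ∑ i, (∑ j, M i j) * v i ^ 2 := by
    rw [Finset.sum_comm]
    refine Finset.sum_congr rfl fun i _ => ?_
    rw [Finset.sum_mul]
    exact Finset.sum_congr rfl fun j _ => by rw [hM]
  have h2 : ∑ i, ∑ j, M i j * v i ^ 2 = ∑ i, (∑ j, M i j) * v i ^ 2 :=
    Finset.sum_congr rfl fun i _ => by rw [Finset.sum_mul]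
  have h3 : ∑ i, ∑ j, M i j * (v i * v j) = ∑ i, v i * ∑ j, M i j * v j := by
    refine Finset.sum_congr rfl fun i _ => ?_
    rw [Finset.mul_sum]
    exact Finset.sum_congr rfl fun j _ => by ring
  calc ∑ i, ∑ j, M i j * (v i - v j) ^ 2
      = ∑ i, ∑ j, (M i j * v i ^ 2 + M i j * v j ^ 2 - 2 * (M i j * (v i * v j))) :=
        Finset.sum_congr rfl fun i _ => Finset.sum_congr rfl fun j _ => by ring
    _ = 2 * (∑ i, (∑ j, M i j) * v i ^ 2 - ∑ i, v i * ∑ j, M i j * v j) := by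
        simp only [Finset.sum_add_distrib, Finset.sum_sub_distrib, ← Finset.mul_sum, h1, h2, h3]
        ring

/-- A symmetric matrix `M` with positive off-diagonal entries and positive row sums `d` is
hyperbolic if `⟨v, M v⟩ ≤ ∑ i, (M v)ᵢ² / dᵢ` for all `v`. -/
theorem hyperbolic_of_le_sum_sq_div {ι : Type*} [Fintype ι] (M : ι → ι → ℝ)
    (hM : ∀ i j, M i j = M j i) (hoff : ∀ i j, i ≠ j → 0 < M i j) (d : ι → ℝ)
    (hd : ∀ i, ∑ j, M i j = d i) (hpos : ∀ i, 0 < d i)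
    (hsq : ∀ v : ι → ℝ, ∑ i, v i * ∑ j, M i j * v j ≤ ∑ i, (∑ j, M i j * v j) ^ 2 / d i)
    (v : ι → ℝ) :
    (∑ i, v i * ∑ j, M i j * v j) * ∑ i, d i ≤ (∑ i, v i * d i) ^ 2 := by
  classical
  rcases isEmpty_or_nonempty ι with hι | hι
  · simp
  set s : ι → ℝ := fun i => √(d i) with hs
  have hs0 : ∀ i, s i ≠ 0 := fun i => (Real.sqrt_pos.2 (hpos i)).ne'
  have hss : ∀ i, s i * s i = d i := fun i => Real.mul_self_sqrt (hpos i).le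
  -- The normalisation `D^(-1/2) M D^(-1/2)` fixes the vector `√d`, which is `φ 1`.
  let N : Matrix ι ι ℝ := fun i j => M i j / (s i * s j)
  have hN : N.IsHermitian := by
    ext i j
    rw [Matrix.conjTranspose_apply, star_trivial]
    simp only [N, hM i j, mul_comm]
  let T := Matrix.toEuclideanLin N
  have hT : T.IsSymmetric := Matrix.isSymmetric_toEuclideanLin_iff.2 hN
  let φ : (ι → ℝ) → EuclideanSpace ℝ ι := fun v => WithLp.toLp 2 fun i => s i * v i
  have hφT : ∀ v i, (T (φ v)) i = (∑ j, M i j * v j) / s i := by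
    intro v i
    change ∑ j, M i j / (s i * s j) * (s j * v j) = _
    rw [Finset.sum_div]
    refine Finset.sum_congr rfl fun j _ => ?_
    have := hs0 i
    have := hs0 j
    field_simp
  have hφ : ∀ x : EuclideanSpace ℝ ι, x = φ fun i => x i / s i := by
    intro x
    ext i
    simp only [φ]
    have := hs0 i
    field_simp
  have hq : ∀ v, inner ℝ (φ v) (T (φ v)) = ∑ i, v i * ∑ j, M i j * v j := by
    intro v
    rw [PiLp.inner_apply]
    refine Finset.sum_congr rfl fun i _ => ?_
    rw [hφT]
    have := hs0 i
    simp only [φ, RCLike.inner_apply, conj_trivial]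
    field_simp
  have hTT : ∀ v, inner ℝ (T (φ v)) (T (φ v)) = ∑ i, (∑ j, M i j * v j) ^ 2 / d i := by
    intro v
    rw [PiLp.inner_apply]
    refine Finset.sum_congr rfl fun i _ => ?_
    rw [hφT, ← hss]
    have := hs0 i
    simp only [RCLike.inner_apply, conj_trivial]
    field_simp
  have hnn : ∀ v, inner ℝ (φ v) (φ v) = ∑ i, d i * v i ^ 2 := by
    intro v
    rw [PiLp.inner_apply]
    refine Finset.sum_congr rfl fun i _ => ?_
    rw [← hss]
    simp only [φ, RCLike.inner_apply, conj_trivial]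
    ring
  have key : ∀ w : ι → ℝ, ∑ i, w i * d i = 0 → ∑ i, w i * ∑ j, M i j * w j ≤ 0 := by
    intro w hw
    rw [← hq]
    refine hT.inner_apply_nonpos_of_inner_eq_zero (φ fun _ => 1) ?_ ?_ _ ?_
    · intro x
      rw [hφ x, hq, hTT]
      exact hsq _
    · intro x hx
      rw [hφ x, hq, hnn] at hx
      -- The Dirichlet form equals `2 (⟨x, x⟩ - ⟨x, T x⟩)`, so `hx` forces each of its nonnegative
      -- terms to vanish.
      have hD := sum_sum_mul_sub_sq M hM fun i => x i / s i
      simp only [hd] at hD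
      have hterm : ∀ i j, 0 ≤ M i j * (x i / s i - x j / s j) ^ 2 := by
        intro i j
        by_cases hij : i = j
        · simp [hij]
        · exact mul_nonneg (hoff i j hij).le (sq_nonneg _)
      have hconst : ∀ i j, x i / s i = x j / s j := by
        intro i j
        by_cases hij : i = j
        · rw [hij]
        have hle : M i j * (x i / s i - x j / s j) ^ 2
            ≤ ∑ i, ∑ j, M i j * (x i / s i - x j / s j) ^ 2 :=
          (Finset.single_le_sum (f := fun j => M i j * (x i / s i - x j / s j) ^ 2)
            (fun j _ => hterm i j) (Finset.mem_univ j)).trans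
          (Finset.single_le_sum (f := fun i => ∑ j, M i j * (x i / s i - x j / s j) ^ 2)
            (fun i _ => Finset.sum_nonneg fun j _ => hterm i j) (Finset.mem_univ i))
        have h0 : M i j * (x i / s i - x j / s j) ^ 2 = 0 :=
          le_antisymm (by linarith) (hterm i j)
        have h1 := (mul_eq_zero.1 h0).resolve_left (hoff i j hij).ne'
        exact sub_eq_zero.1 (pow_eq_zero_iff two_ne_zero |>.1 h1)
      obtain ⟨i₀⟩ := hι
      refine ⟨x i₀ / s i₀, ?_⟩
      ext i
      simp only [φ, PiLp.smul_apply, smul_eq_mul, mul_one]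
      rw [← hconst i i₀, div_mul_cancel₀ _ (hs0 i)]
    · rw [PiLp.inner_apply, ← hw]
      refine Finset.sum_congr rfl fun i _ => ?_
      rw [← hss]
      simp only [φ, RCLike.inner_apply, conj_trivial]
      ring
  have hDpos : 0 < ∑ i, d i := Finset.sum_pos (fun i _ => hpos i) Finset.univ_nonempty
  set D := ∑ i, d i with hDdef
  set L := ∑ i, v i * d i with hL
  have hMd : ∑ i, ∑ j, M i j * v j = L := by
    rw [Finset.sum_comm]
    refine Finset.sum_congr rfl fun i _ => ?_
    rw [← hd, Finset.mul_sum]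
    exact Finset.sum_congr rfl fun j _ => by rw [hM, mul_comm]
  -- Subtracting the `d`-weighted mean `L / D` makes `v` orthogonal to `d`.
  have hk := key (fun i => v i - L / D) (by
    simp only [sub_mul, Finset.sum_sub_distrib, ← Finset.mul_sum]
    field_simp
    simp [← hL, ← hDdef])
  have hexp : ∑ i, (v i - L / D) * ∑ j, M i j * (v j - L / D)
      = ∑ i, v i * ∑ j, M i j * v j - L ^ 2 / D := by
    simp only [mul_sub, Finset.sum_sub_distrib, sub_mul, ← Finset.sum_mul, hd, ← Finset.mul_sum,
      hMd, ← mul_assoc, ← hL, ← hDdef]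
    field_simp
    ring
  rw [hexp, sub_nonpos, le_div_iff₀ hDpos] at hk
  exact hk

/-! ### Removal words and the three-letter comparison -/

section Words

open Finset

variable {Q : Type*}

open Classical in
/-- The elements of `S` with no `r`-predecessor in `S`. -/
noncomputable def mins (r : Q → Q → Prop) (S : Finset Q) : Finset Q :=
  S.filter fun a => ∀ b ∈ S, ¬ r b a

theorem mem_mins {r : Q → Q → Prop} {S : Finset Q} {a : Q} :
    a ∈ mins r S ↔ a ∈ S ∧ ∀ b ∈ S, ¬ r b a := by
  simp [mins]

open Classical in
/-- Comparison of two weighted sums over the words `(x, y, c)` of length three.  Here `m` is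
minimality, and `m₁ x` is minimality after the removal of `x`. -/
theorem sum_words_le_sum_words (S : Finset Q) (W : Q → Q → Q → Prop) (m : Q → Prop)
    (m₁ : Q → Q → Prop) (e : Q → Q → Q → ℝ) (v : Q → ℝ)
    (e_swap_left : ∀ x y c, e x y c = e y x c) (e_swap_right : ∀ x y c, e x y c = e x c y)
    (e_nonneg : ∀ x y c, 0 ≤ e x y c)
    (of_m : ∀ x y c, W x y c → m c → m₁ x c ∧ m₁ y c)
    (m_of : ∀ x y c, W x y c → m₁ x c → m₁ y c → m c)
    (rotate : ∀ x y c, W x y c ∧ m c ↔ W c x y ∧ m x ∧ m₁ x y)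
    (swap_right : ∀ x y c, W x y c ∧ m₁ x c ↔ W x c y ∧ m₁ x y)
    (swap_left : ∀ x y c, W x y c ∧ m y ↔ W y x c ∧ m x) :
    (∑ x ∈ S, ∑ y ∈ S, ∑ c ∈ S,
      if W x y c then v x * (if m y then v y else v x) * e x y c else 0)
    ≤ ∑ x ∈ S, ∑ y ∈ S, ∑ c ∈ S,
      if W x y c then (if m y then v y else v x) * (if m₁ x c then (if m c then v c else v x)
        else (if m y then v y else v x)) * e x y c else 0 := by
  let F (p : Q → Q → Q → Prop) (t : Q → Q → Q → ℝ) (x y c : Q) : ℝ :=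
    if W x y c ∧ p x y c then t x y c * e x y c else 0
  -- Both sums split into five classes. The first four match exactly: by rotation, by swapping the
  -- last two letters, by the identity, by swapping the first two. Only the fifth loses something.
  let F₁ := F (fun _ _ c => m c) fun x y _ => v x * (if m y then v y else v x)
  let F₂ := F (fun x _ c => ¬ m c ∧ m₁ x c) fun x y _ => v x * (if m y then v y else v x)
  let F₃ := F (fun x y c => ¬ m c ∧ ¬ m₁ x c ∧ ¬ m y) fun x _ _ => v x * v x
  let F₄ := F (fun x y c => ¬ m c ∧ ¬ m₁ x c ∧ m y ∧ m₁ y c) fun x y _ => v x * v y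
  let F₅ := F (fun x y c => ¬ m c ∧ ¬ m₁ x c ∧ m y ∧ ¬ m₁ y c) fun x y _ => v x * v y
  let G₁ := F (fun _ y c => m y ∧ m₁ y c) fun _ y c => v y * (if m c then v c else v y)
  let G₂ := F (fun x y c => ¬ m y ∧ m₁ x c) fun x _ c => v x * (if m c then v c else v x)
  let G₃ := F (fun x y c => ¬ m y ∧ ¬ m₁ x c) fun x _ _ => v x * v x
  let G₄ := F (fun x y c => m y ∧ ¬ m₁ y c ∧ m₁ x c) fun x y _ => v y * v x
  let G₅ := F (fun x y c => m y ∧ ¬ m₁ y c ∧ ¬ m₁ x c) fun _ y _ => v y * v y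
  have hL : ∀ x y c, (if W x y c then v x * (if m y then v y else v x) * e x y c else 0)
      = F₁ x y c + F₂ x y c + F₃ x y c + F₄ x y c + F₅ x y c := by
    intro x y c
    simp only [F₁, F₂, F₃, F₄, F₅, F]
    by_cases h : W x y c <;> by_cases h1 : m c <;> by_cases h2 : m₁ x c <;> by_cases h3 : m y <;>
      by_cases h4 : m₁ y c <;> simp only [h, h1, h2, h3, h4] <;> simp
  have hR : ∀ x y c, (if W x y c then (if m y then v y else v x) *
        (if m₁ x c then (if m c then v c else v x) else (if m y then v y else v x)) * e x y c
        else 0)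
      = G₁ x y c + G₂ x y c + G₃ x y c + G₄ x y c + G₅ x y c := by
    intro x y c
    have a1 := of_m x y c
    have a2 := m_of x y c
    simp only [G₁, G₂, G₃, G₄, G₅, F]
    by_cases h : W x y c <;> by_cases h1 : m c <;> by_cases h2 : m₁ x c <;> by_cases h3 : m y <;>
      by_cases h4 : m₁ y c <;> simp only [h, h1, h2, h3, h4] at a1 a2 ⊢ <;> simp at a1 a2 ⊢
  have h1 : ∀ x y c, F₁ x y c = G₁ c x y := by
    intro x y c
    simp only [F₁, G₁, F]
    rw [e_swap_left c x y, e_swap_right x c y]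
    exact if_congr (rotate x y c) rfl rfl
  have h2 : ∀ x y c, F₂ x y c = G₂ x c y := by
    intro x y c
    simp only [F₂, G₂, F]
    rw [e_swap_right x c y]
    refine if_congr ?_ rfl rfl
    have := swap_right x y c
    tauto
  have h3 : ∀ x y c, F₃ x y c = G₃ x y c := by
    intro x y c
    simp only [F₃, G₃, F]
    refine if_congr ?_ rfl rfl
    have := of_m x y c
    tauto
  have h4 : ∀ x y c, F₄ x y c = G₄ y x c := by
    intro x y c
    simp only [F₄, G₄, F]
    rw [e_swap_left y x c]
    refine if_congr ?_ rfl rfl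
    have := of_m x y c
    have := swap_left x y c
    tauto
  -- Here removing only one of `x`, `y` does not make `c` minimal, so the class is symmetric in `x`,
  -- `y` and `2 v_x v_y ≤ v_x² + v_y²` applies.
  have h5 : ∀ x y c, F₅ x y c + F₅ y x c ≤ G₅ x y c + G₅ y x c := by
    intro x y c
    simp only [F₅, G₅, F]
    rw [e_swap_left y x c]
    have := of_m x y c
    have := of_m y x c
    have := swap_left x y c
    by_cases h : W x y c ∧ ¬ m c ∧ ¬ m₁ x c ∧ m y ∧ ¬ m₁ y c
    · rw [if_pos h, if_pos (by tauto), if_pos (by tauto), if_pos (by tauto)]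
      nlinarith [mul_nonneg (e_nonneg x y c) (sq_nonneg (v x - v y))]
    · rw [if_neg h, if_neg (by tauto), if_neg (by tauto), if_neg (by tauto)]
  have s1 : ∑ x ∈ S, ∑ y ∈ S, ∑ c ∈ S, F₁ x y c = ∑ x ∈ S, ∑ y ∈ S, ∑ c ∈ S, G₁ x y c := by
    simp only [h1]
    exact (sum_congr rfl fun x _ => sum_comm).trans sum_comm
  have s2 : ∑ x ∈ S, ∑ y ∈ S, ∑ c ∈ S, F₂ x y c = ∑ x ∈ S, ∑ y ∈ S, ∑ c ∈ S, G₂ x y c := by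
    simp only [h2]
    exact sum_congr rfl fun x _ => sum_comm
  have s4 : ∑ x ∈ S, ∑ y ∈ S, ∑ c ∈ S, F₄ x y c = ∑ x ∈ S, ∑ y ∈ S, ∑ c ∈ S, G₄ x y c := by
    simp only [h4]
    exact sum_comm
  have s5 : ∑ x ∈ S, ∑ y ∈ S, ∑ c ∈ S, F₅ x y c ≤ ∑ x ∈ S, ∑ y ∈ S, ∑ c ∈ S, G₅ x y c := by
    have hF : ∑ x ∈ S, ∑ y ∈ S, ∑ c ∈ S, F₅ y x c = ∑ x ∈ S, ∑ y ∈ S, ∑ c ∈ S, F₅ x y c :=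
      sum_comm
    have hG : ∑ x ∈ S, ∑ y ∈ S, ∑ c ∈ S, G₅ y x c = ∑ x ∈ S, ∑ y ∈ S, ∑ c ∈ S, G₅ x y c :=
      sum_comm
    have hle : ∑ x ∈ S, ∑ y ∈ S, ∑ c ∈ S, (F₅ x y c + F₅ y x c)
        ≤ ∑ x ∈ S, ∑ y ∈ S, ∑ c ∈ S, (G₅ x y c + G₅ y x c) :=
      sum_le_sum fun x _ => sum_le_sum fun y _ => sum_le_sum fun c _ => h5 x y c
    simp only [sum_add_distrib, hF, hG] at hle
    linarith
  simp only [hL, hR, sum_add_distrib, s1, s2, h3, s4]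
  linarith

variable [DecidableEq Q]

/-- The lists of length `n` obtained by successively removing minimal elements from `S`. -/
noncomputable def words (r : Q → Q → Prop) : ℕ → Finset Q → Finset (List Q)
  | 0, _ => {[]}
  | n + 1, S => (mins r S).biUnion fun a => (words r n (S.erase a)).image (List.cons a)

theorem sum_words_succ (r : Q → Q → Prop) (n : ℕ) (S : Finset Q) (g : List Q → ℝ) :
    ∑ l ∈ words r (n + 1) S, g l
      = ∑ a ∈ mins r S, ∑ l ∈ words r n (S.erase a), g (a :: l) := by
  rw [words, sum_biUnion]
  · exact sum_congr rfl fun a _ => sum_image fun l _ l' _ h => (List.cons.inj h).2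
  · intro a _ b _ hab
    rw [Function.onFun, disjoint_left]
    intro l hl hl'
    obtain ⟨m, -, rfl⟩ := mem_image.1 hl
    obtain ⟨m', -, h⟩ := mem_image.1 hl'
    exact hab (List.cons.inj h).1.symm

/-- The number of linear orderings of `S` compatible with `r`. -/
noncomputable def numExt (r : Q → Q → Prop) (S : Finset Q) : ℝ :=
  (words r S.card S).card

theorem numExt_empty (r : Q → Q → Prop) : numExt r ∅ = 1 := by
  simp [numExt, words]

theorem numExt_nonneg (r : Q → Q → Prop) (S : Finset Q) : 0 ≤ numExt r S :=
  Nat.cast_nonneg _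

theorem numExt_eq_sum (r : Q → Q → Prop) {S : Finset Q} (hS : S.Nonempty) :
    numExt r S = ∑ a ∈ mins r S, numExt r (S.erase a) := by
  obtain ⟨n, hn⟩ := Nat.exists_eq_succ_of_ne_zero hS.card_pos.ne'
  have h := sum_words_succ r n S fun _ => 1
  simp only [sum_const, nsmul_eq_mul, mul_one] at h
  rw [numExt, hn, Nat.succ_eq_add_one, h]
  refine sum_congr rfl fun a ha => ?_
  rw [numExt, card_erase_of_mem (mem_mins.1 ha).1, hn]
  rfl

theorem numExt_pos {r : Q → Q → Prop} (hr : ∀ S : Finset Q, S.Nonempty → (mins r S).Nonempty)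
    (S : Finset Q) : 0 < numExt r S := by
  induction S using Finset.strongInduction with
  | H S ih =>
    rcases S.eq_empty_or_nonempty with rfl | hS
    · rw [numExt_empty]; exact one_pos
    · rw [numExt_eq_sum r hS]
      exact sum_pos (fun a ha => ih _ (erase_ssubset (mem_mins.1 ha).1)) (hr S hS)

open Classical in
/-- Transport of a vector on the minimal elements of `S` to the minimal elements of `S.erase a`:
the new minimal elements get the value at `a`. -/
noncomputable def transport (r : Q → Q → Prop) (S : Finset Q) (a : Q) (v : Q → ℝ) (y : Q) : ℝ :=
  if y ∈ mins r S then v y else v a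

/-- The linear map whose matrix is the Hessian attached to `S`. -/
noncomputable def hessMap (r : Q → Q → Prop) (S : Finset Q) (v : Q → ℝ) (x : Q) : ℝ :=
  ∑ y ∈ mins r (S.erase x), transport r S x v y * numExt r ((S.erase x).erase y)

/-- The quadratic form of `hessMap`. -/
noncomputable def hessForm (r : Q → Q → Prop) (S : Finset Q) (v : Q → ℝ) : ℝ :=
  ∑ x ∈ mins r S, v x * hessMap r S v x

open Classical in
theorem sum_triple (r : Q → Q → Prop) (S : Finset Q) (f : Q → Q → Q → ℝ) :
    ∑ x ∈ mins r S, ∑ y ∈ mins r (S.erase x), ∑ c ∈ mins r ((S.erase x).erase y), f x y c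
      = ∑ x ∈ S, ∑ y ∈ S, ∑ c ∈ S,
        if x ∈ mins r S ∧ y ∈ mins r (S.erase x) ∧ c ∈ mins r ((S.erase x).erase y)
          then f x y c else 0 := by
  have hsub : ∀ (U : Finset Q), U ⊆ S → ∀ g : Q → ℝ,
      ∑ x ∈ mins r U, g x = ∑ x ∈ S, if x ∈ mins r U then g x else 0 := by
    intro U hU g
    rw [← sum_filter]
    refine sum_congr ?_ fun _ _ => rfl
    ext x
    simp only [mem_filter, iff_and_self]
    exact fun h => hU (mem_mins.1 h).1
  rw [hsub S subset_rfl]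
  refine sum_congr rfl fun x _ => ?_
  split_ifs with hx
  · rw [hsub _ (erase_subset x S)]
    refine sum_congr rfl fun y _ => ?_
    split_ifs with hy
    · rw [hsub _ ((erase_subset y _).trans (erase_subset x S))]
      exact sum_congr rfl fun c _ => by simp [hx, hy]
    · simp [hy]
  · simp [hx]

/-- Peeling off a third letter requires a nonempty set after two removals, hence three elements. -/
theorem hessForm_eq_sum (r : Q → Q → Prop) {S : Finset Q} (hS : 3 ≤ S.card) (v : Q → ℝ) :
    hessForm r S v = ∑ x ∈ mins r S, ∑ y ∈ mins r (S.erase x),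
      ∑ c ∈ mins r ((S.erase x).erase y),
        v x * transport r S x v y * numExt r (((S.erase x).erase y).erase c) := by
  refine sum_congr rfl fun x hx => ?_
  rw [hessMap, mul_sum]
  refine sum_congr rfl fun y hy => ?_
  rw [numExt_eq_sum r, mul_sum, mul_sum]
  · exact sum_congr rfl fun c _ => by ring
  · rw [← card_pos, card_erase_of_mem (mem_mins.1 hy).1, card_erase_of_mem (mem_mins.1 hx).1]
    omega

theorem sum_hessForm_erase (r : Q → Q → Prop) (S : Finset Q) (v : Q → ℝ) :
    ∑ a ∈ mins r S, hessForm r (S.erase a) (transport r S a v)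
      = ∑ a ∈ mins r S, ∑ b ∈ mins r (S.erase a), ∑ c ∈ mins r ((S.erase a).erase b),
        transport r S a v b * transport r (S.erase a) b (transport r S a v) c
          * numExt r (((S.erase a).erase b).erase c) := by
  refine sum_congr rfl fun a _ => sum_congr rfl fun b _ => ?_
  rw [hessMap, mul_sum]
  exact sum_congr rfl fun c _ => by ring

/-- Both sides are sums over the same three-letter words, weighted by the count for the remaining
set, which does not depend on the order of removal. -/
theorem hessForm_le_sum (r : Q → Q → Prop) {S : Finset Q} (hS : 3 ≤ S.card) (v : Q → ℝ) :
    hessForm r S v ≤ ∑ a ∈ mins r S, hessForm r (S.erase a) (transport r S a v) := by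
  classical
  rw [hessForm_eq_sum r hS, sum_hessForm_erase, sum_triple, sum_triple]
  have := sum_words_le_sum_words S (fun x y c => x ∈ mins r S ∧ y ∈ mins r (S.erase x) ∧
    c ∈ mins r ((S.erase x).erase y)) (· ∈ mins r S) (fun x y => y ∈ mins r (S.erase x))
    (fun x y c => numExt r (((S.erase x).erase y).erase c)) v (fun x y c => by rw [erase_right_comm (a := x)])
    (fun x y c => by rw [erase_right_comm (a := y)])
    (fun x y c => numExt_nonneg _ _) ?_ ?_ ?_ ?_ ?_
  · simp only [transport]
    convert this
  · intro x y c
    simp only [mem_mins, mem_erase]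
    grind
  · intro x y c
    simp only [mem_mins, mem_erase]
    grind
  · intro x y c
    simp only [mem_mins, mem_erase]
    grind
  · intro x y c
    simp only [mem_mins, mem_erase]
    grind
  · intro x y c
    simp only [mem_mins, mem_erase]
    grind

end Words

/-! ### Hyperbolicity by induction on the set -/

section Hyperbolic

open Finset

variable {Q : Type*} [DecidableEq Q]

/-- The matrix of `hessMap` in the basis of minimal elements. -/
noncomputable def hessMatrix (r : Q → Q → Prop) (S : Finset Q) (x y : Q) : ℝ :=
  if x = y then ∑ z ∈ mins r (S.erase x) \ mins r S, numExt r ((S.erase x).erase z)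
  else numExt r ((S.erase x).erase y)

theorem hessMatrix_comm (r : Q → Q → Prop) (S : Finset Q) (x y : Q) :
    hessMatrix r S x y = hessMatrix r S y x := by
  unfold hessMatrix
  by_cases h : x = y
  · rw [h]
  · rw [if_neg h, if_neg (Ne.symm h), erase_right_comm]

/-- Elements exposed by removing `x` carry the value `v x` and feed the diagonal; the others were
already minimal. -/
theorem hessMap_eq_sum_hessMatrix (r : Q → Q → Prop) (S : Finset Q) (v : Q → ℝ) {x : Q}
    (hx : x ∈ mins r S) : hessMap r S v x = ∑ y ∈ mins r S, hessMatrix r S x y * v y := by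
  classical
  have hfilter : (mins r (S.erase x)).filter (· ∈ mins r S) = (mins r S).erase x := by
    ext y
    simp only [mem_filter, mem_mins, mem_erase]
    grind
  rw [hessMap, ← sum_filter_add_sum_filter_not _ (· ∈ mins r S), hfilter, filter_notMem_eq_sdiff,
    ← add_sum_erase _ _ hx, add_comm]
  congr 1
  · rw [hessMatrix, if_pos rfl, sum_mul]
    refine sum_congr rfl fun y hy => ?_
    rw [transport, if_neg (mem_sdiff.1 hy).2, mul_comm]
  · refine sum_congr rfl fun y hy => ?_
    rw [transport, if_pos (mem_erase.1 hy).2, hessMatrix, if_neg (mem_erase.1 hy).1.symm, mul_comm]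

theorem transport_one (r : Q → Q → Prop) (S : Finset Q) (a : Q) :
    transport r S a (fun _ => 1) = fun _ => 1 := by
  ext y
  simp [transport]

theorem hessMap_one (r : Q → Q → Prop) {S : Finset Q} (hS : 2 ≤ S.card) {x : Q}
    (hx : x ∈ mins r S) : hessMap r S (fun _ => 1) x = numExt r (S.erase x) := by
  rw [hessMap, numExt_eq_sum r, transport_one]
  · simp
  · rw [← card_pos, card_erase_of_mem (mem_mins.1 hx).1]
    omega

theorem hessForm_hyperbolic_of_le {r : Q → Q → Prop}
    (hr : ∀ S : Finset Q, S.Nonempty → (mins r S).Nonempty) {S : Finset Q} (hS : 2 ≤ S.card)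
    (hsq : ∀ v, hessForm r S v ≤ ∑ x ∈ mins r S, hessMap r S v x ^ 2 / numExt r (S.erase x))
    (v : Q → ℝ) :
    hessForm r S v * numExt r S ≤ (∑ x ∈ mins r S, v x * numExt r (S.erase x)) ^ 2 := by
  classical
  have hmap : ∀ (w : Q → ℝ) (x : {x // x ∈ mins r S}),
      ∑ y : {x // x ∈ mins r S}, hessMatrix r S x y * w y = hessMap r S w x := by
    intro w x
    rw [hessMap_eq_sum_hessMatrix r S w x.2]
    exact sum_coe_sort (mins r S) fun y => hessMatrix r S x y * w y
  have hform : ∀ w : Q → ℝ, ∑ x : {x // x ∈ mins r S}, w x *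
      ∑ y : {x // x ∈ mins r S}, hessMatrix r S x y * w y = hessForm r S w := by
    intro w
    simp only [hmap]
    exact sum_coe_sort (mins r S) fun x => w x * hessMap r S w x
  have key := hyperbolic_of_le_sum_sq_div (ι := {x // x ∈ mins r S})
    (fun x y => hessMatrix r S x y) (fun x y => hessMatrix_comm r S x y)
    (fun x y hxy => by
      rw [hessMatrix, if_neg fun h => hxy (Subtype.ext h)]
      exact numExt_pos hr _)
    (fun x => numExt r (S.erase x))
    (fun x => by
      have := hmap (fun _ => 1) x
      rwa [hessMap_one r hS x.2, sum_congr rfl fun y _ => mul_one _] at this)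
    (fun x => numExt_pos hr _)
    (fun v => by
      let w : Q → ℝ := fun q => if h : q ∈ mins r S then v ⟨q, h⟩ else 0
      have hw : v = fun x : {x // x ∈ mins r S} => w x := by
        ext x
        simp [w]
      rw [hw, hform]
      simp only [hmap]
      exact (hsq w).trans_eq
        (sum_coe_sort (mins r S) fun x => hessMap r S w x ^ 2 / numExt r (S.erase x)).symm)
    (fun x => v x)
  rw [hform, sum_coe_sort (mins r S) fun x => numExt r (S.erase x),
    sum_coe_sort (mins r S) fun x => v x * numExt r (S.erase x),
    ← numExt_eq_sum r (card_pos.1 (by omega))] at key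
  exact key

theorem numExt_of_card_eq_one {r : Q → Q → Prop}
    (hr : ∀ S : Finset Q, S.Nonempty → (mins r S).Nonempty) {S : Finset Q} (hS : S.card = 1) :
    numExt r S = 1 := by
  obtain ⟨a, rfl⟩ := card_eq_one.1 hS
  have h : mins r {a} = {a} :=
    (hr {a} (singleton_nonempty a)).subset_singleton_iff.1 fun x hx => (mem_mins.1 hx).1
  rw [numExt_eq_sum r (singleton_nonempty a), h, sum_singleton, erase_singleton, numExt_empty]

/-- Base case, too small for `hessForm_le_sum`. With two minimal elements it is `2 v_a v_b ≤ v_a² +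
v_b²`; otherwise equality holds. -/
theorem hessForm_le_of_card_eq_two {r : Q → Q → Prop}
    (hr : ∀ S : Finset Q, S.Nonempty → (mins r S).Nonempty) {S : Finset Q} (hS : S.card = 2)
    (v : Q → ℝ) :
    hessForm r S v ≤ ∑ x ∈ mins r S, hessMap r S v x ^ 2 / numExt r (S.erase x) := by
  have hmap : ∀ a b, S = {a, b} → a ≠ b → hessMap r S v a = transport r S a v b := by
    rintro a b rfl hab
    have h1 : ({a, b} : Finset Q).erase a = {b} := by
      ext x
      simp only [mem_erase, mem_insert, mem_singleton]
      grind
    have h : mins r {b} = {b} :=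
      (hr {b} (singleton_nonempty b)).subset_singleton_iff.1 fun x hx => (mem_mins.1 hx).1
    rw [hessMap, h1, h, sum_singleton, erase_singleton, numExt_empty, mul_one]
  have hone : ∀ x ∈ mins r S, numExt r (S.erase x) = 1 := fun x hx =>
    numExt_of_card_eq_one hr (by rw [card_erase_of_mem (mem_mins.1 hx).1, hS])
  have hgoal : ∑ x ∈ mins r S, v x * hessMap r S v x ≤ ∑ x ∈ mins r S, hessMap r S v x ^ 2 := by
    obtain ⟨a, b, hab, hSab⟩ := card_eq_two.1 hS
    have ha := hmap a b hSab hab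
    have hb := hmap b a (by rw [hSab, pair_comm]) hab.symm
    have hsub : mins r S ⊆ {a, b} := fun x hx => hSab ▸ (mem_mins.1 hx).1
    by_cases h1 : a ∈ mins r S <;> by_cases h2 : b ∈ mins r S
    · have h : mins r S = {a, b} := by
        refine hsub.antisymm ?_
        simp [insert_subset_iff, h1, h2]
      rw [transport, if_pos h2] at ha
      rw [transport, if_pos h1] at hb
      rw [h, sum_pair hab, sum_pair hab, ha, hb]
      nlinarith [sq_nonneg (v a - v b)]
    · have h : mins r S = {a} := by
        ext x
        have := @hsub x
        simp only [mem_insert, mem_singleton] at this ⊢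
        grind
      rw [transport, if_neg h2] at ha
      rw [h, sum_singleton, sum_singleton, ha, sq]
    · have h : mins r S = {b} := by
        ext x
        have := @hsub x
        simp only [mem_insert, mem_singleton] at this ⊢
        grind
      rw [transport, if_neg h1] at hb
      rw [h, sum_singleton, sum_singleton, hb, sq]
    · have h : mins r S = ∅ := by
        ext x
        have := @hsub x
        simp only [mem_insert, mem_singleton] at this
        grind
      rw [h, sum_empty, sum_empty]
  refine hgoal.trans_eq (sum_congr rfl fun x hx => ?_)
  rw [hone x hx, div_one]

theorem hessForm_hyperbolic {r : Q → Q → Prop}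
    (hr : ∀ S : Finset Q, S.Nonempty → (mins r S).Nonempty) {S : Finset Q} (hS : 2 ≤ S.card)
    (v : Q → ℝ) :
    hessForm r S v * numExt r S ≤ (∑ x ∈ mins r S, v x * numExt r (S.erase x)) ^ 2 := by
  induction S using Finset.strongInduction generalizing v with
  | H S ih =>
    refine hessForm_hyperbolic_of_le hr hS (fun v => ?_) v
    rcases hS.eq_or_lt with h2 | h3
    · exact hessForm_le_of_card_eq_two hr h2.symm v
    · refine (hessForm_le_sum r h3 v).trans (sum_le_sum fun a ha => ?_)
      rw [le_div_iff₀ (numExt_pos hr _)]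
      have haS := (mem_mins.1 ha).1
      -- The linear functional for `S.erase a`, evaluated at the transported vector, is `hessMap r S
      -- v a` by definition.
      exact ih _ (erase_ssubset haS) (by rw [card_erase_of_mem haS]; omega) _

theorem numExt_mul_le_two_mul {r : Q → Q → Prop}
    (hr : ∀ S : Finset Q, S.Nonempty → (mins r S).Nonempty) {S : Finset Q} {a b : Q}
    (ha : a ∈ mins r S) (hb : b ∈ mins r S) (hab : a ≠ b) :
    numExt r ((S.erase a).erase b) * numExt r S
      ≤ 2 * (numExt r (S.erase a) * numExt r (S.erase b)) := by
  have hS : 2 ≤ S.card := by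
    rw [← card_pair hab]
    refine card_le_card ?_
    simp [insert_subset_iff, (mem_mins.1 ha).1, (mem_mins.1 hb).1]
  set p := numExt r (S.erase a)
  set q := numExt r (S.erase b)
  have hp : 0 < p := numExt_pos hr _
  have hq : 0 < q := numExt_pos hr _
  have hpair : ({a, b} : Finset Q) ⊆ mins r S := by simp [insert_subset_iff, ha, hb]
  -- These weights make both terms of the linear functional equal to `p * q`; the diagonal part of
  -- the form is nonnegative and is dropped.
  let v : Q → ℝ := fun x => if x = a then q else if x = b then p else 0
  have hva : v a = q := by simp [v]
  have hvb : v b = p := by simp [v, hab.symm]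
  have hv0 : ∀ x, x ∉ ({a, b} : Finset Q) → v x = 0 := by
    intro x hx
    simp only [mem_insert, mem_singleton, not_or] at hx
    simp [v, hx.1, hx.2]
  have hdiag : ∀ x, 0 ≤ hessMatrix r S x x := fun x => by
    rw [hessMatrix, if_pos rfl]
    exact sum_nonneg fun _ _ => numExt_nonneg _ _
  have hsum : ∀ f : Q → ℝ, (∀ x ∉ ({a, b} : Finset Q), f x = 0) →
      ∑ x ∈ mins r S, f x = f a + f b := fun f hf => by
    rw [← sum_subset hpair fun x _ hx => hf x hx, sum_pair hab]
  have h := hessForm_hyperbolic hr hS v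
  have hmap : ∀ x ∈ mins r S,
      hessMap r S v x = hessMatrix r S x a * q + hessMatrix r S x b * p := fun x hx => by
    rw [hessMap_eq_sum_hessMatrix r S v hx, hsum _ fun y hy => by rw [hv0 y hy, mul_zero],
      hva, hvb]
  rw [hessForm, hsum _ fun x hx => by rw [hv0 x hx, zero_mul],
    hsum _ fun x hx => by rw [hv0 x hx, zero_mul], hva, hvb, hmap a ha, hmap b hb,
    hessMatrix_comm r S b a] at h
  have hoff : hessMatrix r S a b = numExt r ((S.erase a).erase b) := if_neg hab
  rw [hoff] at h
  set t := numExt r ((S.erase a).erase b)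
  set E := numExt r S
  have hE : 0 < E := numExt_pos hr _
  have hle : 2 * (p * q) * (t * E) ≤ 2 * (p * q) * (2 * (p * q)) := by
    have h1 := mul_nonneg (mul_nonneg (sq_nonneg q) (hdiag a)) hE.le
    have h2 := mul_nonneg (mul_nonneg (sq_nonneg p) (hdiag b)) hE.le
    nlinarith
  exact le_of_mul_le_mul_left hle (by positivity)

end Hyperbolic

/-! ### Counting extensions after adjoining elements below given sets -/

section Adjoin

open Finset

variable {X J : Type*}

/-- The relation on `X ⊕ J` that extends `r` and puts `j` below the elements of `C j`. -/
def adjoinBelow (r : X → X → Prop) (C : J → Set X) : X ⊕ J → X ⊕ J → Prop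
  | .inl x, .inl y => r x y
  | .inr j, .inl x => x ∈ C j
  | _, .inr _ => False

variable (r : X → X → Prop) (C : J → Set X)

theorem inl_mem_mins_adjoinBelow {S : Finset X} {T : Finset J} {x : X} :
    .inl x ∈ mins (adjoinBelow r C) (S.disjSum T) ↔ x ∈ mins r S ∧ ∀ j ∈ T, x ∉ C j := by
  simp [mem_mins, adjoinBelow, and_assoc]

theorem inr_mem_mins_adjoinBelow {S : Finset X} {T : Finset J} {j : J} :
    .inr j ∈ mins (adjoinBelow r C) (S.disjSum T) ↔ j ∈ T := by
  simp [mem_mins, adjoinBelow]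

open Classical in
theorem mins_adjoinBelow (S : Finset X) (T : Finset J) :
    mins (adjoinBelow r C) (S.disjSum T)
      = ((mins r S).filter fun x => ∀ j ∈ T, x ∉ C j).disjSum T := by
  ext (x | j)
  · simp [inl_mem_mins_adjoinBelow]
  · simp [inr_mem_mins_adjoinBelow]

/-- `adjoinBelow` need not be transitive; existence of minimal elements is all that the inequality
needs. -/
theorem mins_adjoinBelow_nonempty (hr : ∀ S : Finset X, S.Nonempty → (mins r S).Nonempty)
    (S : Finset (X ⊕ J)) (hS : S.Nonempty) : (mins (adjoinBelow r C) S).Nonempty := by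
  classical
  obtain ⟨U, T, rfl⟩ : ∃ (U : Finset X) (T : Finset J), S = U.disjSum T :=
    ⟨S.toLeft, S.toRight, (toLeft_disjSum_toRight).symm⟩
  rcases T.eq_empty_or_nonempty with rfl | ⟨j, hj⟩
  · have hU : U.Nonempty := by
      obtain ⟨x | j, h⟩ := hS
      · exact ⟨x, inl_mem_disjSum.1 h⟩
      · simp at h
    obtain ⟨x, hx⟩ := hr U hU
    exact ⟨.inl x, (inl_mem_mins_adjoinBelow r C).2 ⟨hx, by simp⟩⟩
  · exact ⟨.inr j, (inr_mem_mins_adjoinBelow r C).2 hj⟩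

open Classical in
/-- The position in the list `l` of its first element in `A`, starting from `1`. -/
noncomputable def firstPos (A : Set X) (l : List X) : ℕ :=
  l.findIdx (· ∈ A) + 1

/-- A word avoiding `A` has `firstPos` equal to its length plus one, the number of all its gaps, so
the counts below need no nonemptiness of the sets `C j`. -/
theorem firstPos_nil (A : Set X) : firstPos A [] = 1 := rfl

open Classical in
theorem firstPos_cons (A : Set X) (x : X) (l : List X) :
    firstPos A (x :: l) = if x ∈ A then 1 else firstPos A l + 1 := by
  unfold firstPos
  rw [List.findIdx_cons]
  by_cases h : x ∈ A <;> simp [h]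

variable [DecidableEq X] [DecidableEq J]

theorem disjSum_erase_inl (S : Finset X) (T : Finset J) (x : X) :
    (S.disjSum T).erase (.inl x) = (S.erase x).disjSum T := by
  ext (y | j) <;> simp

theorem disjSum_erase_inr (S : Finset X) (T : Finset J) (j : J) :
    (S.disjSum T).erase (.inr j) = S.disjSum (T.erase j) := by
  ext (y | j) <;> simp

open Classical in
theorem numExt_adjoinBelow_eq_sum {S : Finset X} {T : Finset J} (h : (S.disjSum T).Nonempty) :
    numExt (adjoinBelow r C) (S.disjSum T)
      = (∑ x ∈ mins r S, if ∀ j ∈ T, x ∉ C j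
          then numExt (adjoinBelow r C) ((S.erase x).disjSum T) else 0)
        + ∑ j ∈ T, numExt (adjoinBelow r C) (S.disjSum (T.erase j)) := by
  rw [numExt_eq_sum _ h, mins_adjoinBelow, sum_disjSum, sum_filter]
  simp only [disjSum_erase_inl, disjSum_erase_inr]

theorem numExt_adjoinBelow_empty (n : ℕ) (S : Finset X) (hn : S.card = n) :
    numExt (adjoinBelow r C) (S.disjSum ∅) = ∑ _l ∈ words r n S, 1 := by
  classical
  induction n generalizing S with
  | zero =>
    rw [card_eq_zero.1 hn]
    simp [numExt_empty, words]
  | succ n ih =>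
    have hS : S.Nonempty := card_pos.1 (by omega)
    rw [numExt_adjoinBelow_eq_sum r C (by simpa using hS), sum_words_succ, sum_empty, add_zero]
    refine sum_congr rfl fun x hx => ?_
    rw [if_pos (by simp), ih _ (by rw [card_erase_of_mem (mem_mins.1 hx).1, hn]; rfl)]

/-- The element `j` may occupy any gap before the first letter in `C j`. -/
theorem numExt_adjoinBelow_singleton (j : J) (n : ℕ) (S : Finset X) (hn : S.card = n) :
    numExt (adjoinBelow r C) (S.disjSum {j}) = ∑ l ∈ words r n S, (firstPos (C j) l : ℝ) := by
  classical
  induction n generalizing S with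
  | zero =>
    rw [numExt_adjoinBelow_eq_sum r C ⟨.inr j, by simp⟩, sum_singleton, erase_singleton,
      numExt_adjoinBelow_empty r C 0 S hn, card_eq_zero.1 hn]
    simp [words, firstPos_nil, mins]
  | succ n ih =>
    rw [numExt_adjoinBelow_eq_sum r C ⟨.inr j, by simp⟩, sum_singleton, erase_singleton,
      numExt_adjoinBelow_empty r C _ S hn, sum_words_succ, sum_words_succ, ← sum_add_distrib]
    refine sum_congr rfl fun x hx => ?_
    have hc : (S.erase x).card = n := by rw [card_erase_of_mem (mem_mins.1 hx).1, hn]; rfl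
    simp only [mem_singleton, forall_eq, firstPos_cons]
    by_cases h : x ∈ C j
    · simp [h]
    · simp only [h, not_false_eq_true, if_true, if_false]
      rw [ih _ hc, ← sum_add_distrib]
      push_cast
      rfl

/-- The gaps are chosen independently, and each of the `min` common gaps gives one extra
arrangement, since `i` and `j` are incomparable. -/
theorem numExt_adjoinBelow_pair {i j : J} (hij : i ≠ j) (n : ℕ) (S : Finset X)
    (hn : S.card = n) :
    numExt (adjoinBelow r C) (S.disjSum {i, j})
      = ∑ l ∈ words r n S, ((firstPos (C i) l : ℝ) * firstPos (C j) l
          + min (firstPos (C i) l : ℝ) (firstPos (C j) l)) := by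
  classical
  have h1 : ({i, j} : Finset J).erase i = {j} := by
    ext k; simp only [mem_erase, mem_insert, mem_singleton]; grind
  have h2 : ({i, j} : Finset J).erase j = {i} := by
    ext k; simp only [mem_erase, mem_insert, mem_singleton]; grind
  induction n generalizing S with
  | zero =>
    rw [numExt_adjoinBelow_eq_sum r C ⟨.inr j, by simp⟩, sum_pair hij, h1, h2,
      numExt_adjoinBelow_singleton r C _ 0 S hn, numExt_adjoinBelow_singleton r C _ 0 S hn,
      card_eq_zero.1 hn]
    simp [words, firstPos_nil, mins]
  | succ n ih =>
    rw [numExt_adjoinBelow_eq_sum r C ⟨.inr j, by simp⟩, sum_pair hij, h1, h2,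
      numExt_adjoinBelow_singleton r C _ _ S hn, numExt_adjoinBelow_singleton r C _ _ S hn,
      sum_words_succ, sum_words_succ, sum_words_succ, ← sum_add_distrib, ← sum_add_distrib]
    refine sum_congr rfl fun x hx => ?_
    have hc : (S.erase x).card = n := by rw [card_erase_of_mem (mem_mins.1 hx).1, hn]; rfl
    have hone : ∀ A : Set X, ∀ l : List X, (1 : ℝ) ≤ firstPos A l := fun A l => by
      exact_mod_cast Nat.succ_pos _
    simp only [mem_insert, mem_singleton, forall_eq_or_imp, forall_eq, firstPos_cons]
    rw [← sum_add_distrib]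
    by_cases hi : x ∈ C i <;> by_cases hj : x ∈ C j
    · simp only [hi, hj, not_true, if_true, false_and, if_false, zero_add]
      refine sum_congr rfl fun l _ => ?_
      norm_num
    · simp only [hi, hj, not_true, if_true, false_and, if_false, zero_add]
      refine sum_congr rfl fun l _ => ?_
      have := hone (C j) l
      push_cast
      rw [min_eq_left (by linarith)]
      ring
    · simp only [hi, hj, not_true, if_true, and_false, if_false, zero_add]
      refine sum_congr rfl fun l _ => ?_
      have := hone (C i) l
      push_cast
      rw [min_eq_right (by linarith)]
      ring
    -- With old positions `p`, `q`: `(p+1)(q+1) + min p q + 1 = (pq + min p q) + (p+1) + (q+1)`.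
    · simp only [hi, hj, not_false_eq_true, if_true, and_self, if_false]
      rw [ih _ hc, ← sum_add_distrib]
      refine sum_congr rfl fun l _ => ?_
      push_cast
      rw [min_add_add_right]
      ring

/-- The correlation inequality for the first positions of two sets in a uniformly random word. -/
theorem sum_words_firstPos_le (hr : ∀ S : Finset X, S.Nonempty → (mins r S).Nonempty)
    (A B : Set X) (S : Finset X) :
    (∑ _l ∈ words r S.card S, (1 : ℝ)) * ∑ l ∈ words r S.card S,
        ((firstPos A l : ℝ) * firstPos B l + min (firstPos A l : ℝ) (firstPos B l))
      ≤ 2 * ((∑ l ∈ words r S.card S, (firstPos A l : ℝ))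
        * ∑ l ∈ words r S.card S, (firstPos B l : ℝ)) := by
  let C : Bool → Set X := fun b => if b then A else B
  have h := numExt_mul_le_two_mul (mins_adjoinBelow_nonempty r C hr)
    (S := S.disjSum {true, false}) (a := .inr false) (b := .inr true)
    ((inr_mem_mins_adjoinBelow r C).2 (by simp)) ((inr_mem_mins_adjoinBelow r C).2 (by simp))
    (by simp)
  have h1 : ({true, false} : Finset Bool).erase false = {true} := rfl
  have h2 : ({true, false} : Finset Bool).erase true = {false} := rfl
  rw [disjSum_erase_inr, disjSum_erase_inr, disjSum_erase_inr, h1, h2, erase_singleton,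
    numExt_adjoinBelow_empty r C _ S rfl, numExt_adjoinBelow_singleton r C _ _ S rfl,
    numExt_adjoinBelow_singleton r C _ _ S rfl,
    numExt_adjoinBelow_pair r C (by simp) _ S rfl] at h
  exact h

end Adjoin

/-! ### From words back to linear extensions -/

section LinearExtensions

open Finset

theorem mem_words {X : Type*} [DecidableEq X] {r : X → X → Prop} (hirr : ∀ x, ¬ r x x) (n : ℕ)
    (S : Finset X) (hn : S.card = n) (l : List X) :
    l ∈ words r n S ↔ l.Nodup ∧ l.toFinset = S ∧ l.Pairwise fun x y => ¬ r y x := by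
  induction n generalizing S l with
  | zero =>
    rw [card_eq_zero.1 hn]
    simp only [words, mem_singleton, List.toFinset_eq_empty_iff]
    constructor
    · rintro rfl; simp
    · exact fun h => h.2.1
  | succ n ih =>
    simp only [words, mem_biUnion, mem_image]
    constructor
    · rintro ⟨a, ha, m, hm, rfl⟩
      have haS := (mem_mins.1 ha).1
      rw [ih _ (by rw [card_erase_of_mem haS, hn]; rfl)] at hm
      obtain ⟨h1, h2, h3⟩ := hm
      have hmem : ∀ y, y ∈ m ↔ y ∈ S.erase a := fun y => by rw [← h2, List.mem_toFinset]
      refine ⟨List.nodup_cons.2 ⟨fun h => by simp [hmem] at h, h1⟩, ?_,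
        List.pairwise_cons.2 ⟨fun y hy => (mem_mins.1 ha).2 y (mem_of_mem_erase ((hmem y).1 hy)),
          h3⟩⟩
      rw [List.toFinset_cons, h2, insert_erase haS]
    · rintro ⟨h1, h2, h3⟩
      cases l with
      | nil => simp [← h2] at hn
      | cons a m =>
        rw [List.nodup_cons] at h1
        rw [List.pairwise_cons] at h3
        rw [List.toFinset_cons] at h2
        have haS : a ∈ S := by simp [← h2]
        refine ⟨a, mem_mins.2 ⟨haS, fun b hb => ?_⟩, m, ?_, rfl⟩
        · rw [← h2, mem_insert, List.mem_toFinset] at hb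
          rcases hb with rfl | hb
          · exact hirr b
          · exact h3.1 b hb
        · rw [ih _ (by rw [card_erase_of_mem haS, hn]; rfl)]
          refine ⟨h1.2, ?_, h3.2⟩
          rw [← h2, erase_insert (by simpa using h1.1)]

namespace LinExt

variable {X : Type*} [PartialOrder X] [Fintype X]

/-- A linear extension corresponds to the list of elements in increasing order of label. -/
theorem sum_words_eq_sum [DecidableEq X] (g : List X → ℝ) :
    ∑ l ∈ words (fun x y : X => x < y) (univ : Finset X).card univ, g l
      = ∑ f : LinExt X, g (List.ofFn f.1.symm) := by
  have hmem := mem_words (r := fun x y : X => x < y) (fun x => lt_irrefl x) _ univ rfl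
  symm
  refine sum_bij (fun f _ => List.ofFn f.1.symm) (fun f _ => ?_) (fun f _ f' _ h => ?_)
    (fun l hl => ?_) fun _ _ => rfl
  · rw [hmem]
    refine ⟨List.nodup_ofFn.2 f.1.symm.injective, ?_, List.pairwise_ofFn.2 fun i j hij h => ?_⟩
    · ext x
      simp only [List.mem_toFinset, List.mem_ofFn, mem_univ, iff_true]
      exact ⟨f.1 x, f.1.symm_apply_apply x⟩
    · have := f.2 h
      simp only [Equiv.apply_symm_apply] at this
      exact absurd this hij.not_gt
  · have := List.ofFn_injective h
    exact Subtype.ext (Equiv.symm_bijective.injective (DFunLike.coe_injective this))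
  · obtain ⟨h1, h2, h3⟩ := (hmem l).1 hl
    have hlen : l.length = Fintype.card X := by
      rw [← List.toFinset_card_of_nodup h1, h2, card_univ]
    let F : Fin (Fintype.card X) → X := fun i => l.get (i.cast hlen.symm)
    have hF : Function.Bijective F := by
      rw [Fintype.bijective_iff_injective_and_card]
      refine ⟨fun i j hij => ?_, by simp⟩
      simpa using h1.injective_get hij
    let E := Equiv.ofBijective F hF
    refine ⟨⟨E.symm, fun x y hxy => ?_⟩, mem_univ _, ?_⟩
    · by_contra hlt
      rcases (not_lt.1 hlt).eq_or_lt with h | h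
      · exact hxy.ne (E.symm.injective h).symm
      · have := List.pairwise_iff_get.1 h3 ((E.symm y).cast hlen.symm)
          ((E.symm x).cast hlen.symm) (by simpa using h)
        have hx : F (E.symm x) = x := E.apply_symm_apply x
        have hy : F (E.symm y) = y := E.apply_symm_apply y
        change ¬ F (E.symm x) < F (E.symm y) at this
        rw [hx, hy] at this
        exact this hxy
    · change List.ofFn F = l
      refine List.ext_getElem (by simp [hlen]) fun i _ _ => ?_
      simp [F]

theorem minLabel_eq_firstPos (f : LinExt X) {A : Set X} (hA : A.Nonempty) :
    f.minLabel A = firstPos A (List.ofFn f.1.symm) := by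
  classical
  refine IsLeast.csInf_eq ⟨?_, ?_⟩
  · obtain ⟨x, hx⟩ := hA
    have hlt : (List.ofFn f.1.symm).findIdx (fun y => decide (y ∈ A))
        < (List.ofFn f.1.symm).length := by
      rw [List.findIdx_lt_length]
      exact ⟨x, by simpa using ⟨f.1 x, f.1.symm_apply_apply x⟩, by simpa using hx⟩
    have h := List.findIdx_getElem (w := hlt)
    rw [List.getElem_ofFn, decide_eq_true_iff] at h
    refine ⟨_, h, ?_⟩
    simp only [label, Equiv.apply_symm_apply, firstPos]
  · rintro _ ⟨x, hx, rfl⟩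
    unfold label firstPos
    by_contra hlt
    have h := List.not_of_lt_findIdx (Nat.lt_of_succ_lt_succ (not_le.1 hlt))
    rw [List.getElem_ofFn] at h
    simp [hx] at h

theorem minLabel_union (f : LinExt X) {A B : Set X} (hA : A.Nonempty) (hB : B.Nonempty) :
    f.minLabel (A ∪ B) = min (f.minLabel A) (f.minLabel B) := by
  unfold minLabel
  rw [Set.image_union, csInf_union (OrderBot.bddBelow _) (hA.image _) (OrderBot.bddBelow _)
    (hB.image _)]

end LinExt

end LinearExtensions

theorem theoremt {X : Type*} [PartialOrder X] [Fintype X] (A B : Set X)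
    (hA : A.Nonempty) (hB : B.Nonempty) :
    (LinExt.expectation (fun f : LinExt X => (f.minLabel A : ℝ) * (f.minLabel B : ℝ))
        + LinExt.expectation (fun f : LinExt X => (f.minLabel (A ∪ B) : ℝ)))
      / (LinExt.expectation (fun f : LinExt X => (f.minLabel A : ℝ))
        * LinExt.expectation (fun f : LinExt X => (f.minLabel B : ℝ))) ≤ 2 := by
  classical
  have hA1 := LinExt.one_le_expectation_minLabel hA
  have hB1 := LinExt.one_le_expectation_minLabel hB
  rw [div_le_iff₀ (by positivity)]
  have hmins : ∀ S : Finset X, S.Nonempty → (mins (fun x y : X => x < y) S).Nonempty := by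
    intro S hS
    obtain ⟨x, hx⟩ := S.exists_minimal hS
    exact ⟨x, mem_mins.2 ⟨hx.1, fun b hb hlt => hlt.not_ge (hx.2 hb hlt.le)⟩⟩
  have h := sum_words_firstPos_le (fun x y : X => x < y) hmins A B Finset.univ
  simp only [LinExt.sum_words_eq_sum] at h
  simp only [← LinExt.minLabel_eq_firstPos _ hA, ← LinExt.minLabel_eq_firstPos _ hB,
    ← Nat.cast_min, ← LinExt.minLabel_union _ hA hB, Finset.sum_add_distrib, Finset.sum_const,
    nsmul_eq_mul, mul_one] at h
  have hcard : (0 : ℝ) < (Finset.univ : Finset (LinExt X)).card := by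
    have := LinExt.nonempty X
    exact_mod_cast Finset.card_pos.2 Finset.univ_nonempty
  simp only [LinExt.expectation, Finset.expect_eq_sum_div_card]
  rw [← add_div, div_mul_div_comm, mul_div_assoc', div_le_div_iff₀ hcard (by positivity)]
  -- The right side has one more factor of the number of extensions in its denominator, so `h` is
  -- multiplied by that number.
  nlinarith [mul_le_mul_of_nonneg_right h hcard.le]
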